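/- Let $\beta:\mathbb R^2\to\mathbb R$ be integrable, with Fourier transform $\widehat\beta(\xi)=\int_{\mathbb R^2}e^{-2\pi i z\cdot\xi}\beta(z)\,dz$ (another normalization only changes the constant $C$) that is real and satisfies $0\le\widehat\beta(\xi)\le C(1+|\xi|^2)^{-r/2}$ for all $\xi\in\mathbb R^2$, with some $C>0$ and some $r\ge 2$. Let $s\ge 1$, let $F\in C^{\lfloor s\rfloor+1}(\mathbb R)$ be real-valued with $F(0)=0$, and let $X^s$ be the space of real functions $w\in H^s(\mathbb R^2)$ with $w_x,w_y\in L^\infty(\mathbb R^2)$, with the norm $\|w\|_{H^s}+\|w_x\|_{L^\infty}+\|w_y\|_{L^\infty}$. Let $0<T\le\infty$, $\varphi,\psi\in X^s$, and let $w\in C^2([0,T),X^s)$ be a solution of the Cauchy problem $$w_{tt}=\Big(\beta*\frac{\partial F}{\partial w_x}\Big)_x+\Big(\beta*\frac{\partial F}{\partial w_y}\Big)_y\quad(0<t<T),\qquad w(0)=\varphi,\quad w_t(0)=\psi,$$ where $\frac{\partial F}{\partial w_x}=2w_xF'(|\nabla w|^2)$, $\frac{\partial F}{\partial w_y}=2w_yF'(|\nabla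 w|^2)$ and the outer derivatives are taken in the sense of distributions. Let $R$ be the unbounded operator $Ru=\mathcal F^{-1}\big(\widehat\beta^{-1/2}\,\widehat u\big)$ on $L^2(\mathbb R^2)$; here $Ru\in L^2$ means that $\widehat u=0$ almost everywhere on $\{\widehat\beta=0\}$ and that $\widehat\beta^{-1/2}\widehat u$ (set equal to $0$ where $\widehat\beta=0$) is in $L^2$. If $R\psi\in L^2(\mathbb R^2)$ and $F(|\nabla\varphi|^2)\in L^1(\mathbb R^2)$, then for every $t\in[0,T)$ we have $Rw_t(t)\in L^2(\mathbb R^2)$ and $F(|\nabla w(t)|^2)\in L^1(\mathbb R^2)$, and the energy $$E(t)=\tfrac12\|Rw_t(t)\|_{L^2}^2+\int_{\mathbb R^2}F(|\nabla w(t)|^2)\,dx\,dy$$ satisfies $E(t)=E(0)$; that is, $E$ is constant on $[0,T)$. -/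

import Mathlib

open MeasureTheory FourierTransform Set
open scoped SchwartzMap LineDeriv ENNReal Convolution ContDiff

noncomputable section

namespace NonlocalWave

/-- The plane `ℝ²` with its Euclidean norm and Lebesgue measure. -/
abbrev Plane : Type := EuclideanSpace ℝ (Fin 2)

/-- The standard basis vectors of the plane. -/
abbrev e (i : Fin 2) : Plane := EuclideanSpace.single i (1 : ℝ)

/-- A real `L^p` function regarded as a complex-valued one. -/
def toC (p : ℝ≥0∞) [Fact (1 ≤ p)] :
    Lp ℝ p (volume : Measure Plane) →L[ℝ] Lp ℂ p (volume : Measure Plane) :=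
  Complex.ofRealCLM.compLpL p volume

/-- A real `L^p` function regarded as a tempered distribution. -/
def distr (p : ℝ≥0∞) [Fact (1 ≤ p)] (u : Lp ℝ p (volume : Measure Plane)) : 𝓢'(Plane, ℂ) :=
  Lp.toTemperedDistribution (toC p u)

variable {p : ℝ≥0∞} [Fact (1 ≤ p)]

theorem distr_add (u v : Lp ℝ p (volume : Measure Plane)) :
    distr p (u + v) = distr p u + distr p v := by
  simp only [distr, map_add, ← Lp.toTemperedDistributionCLM_apply]

theorem distr_smul (c : ℝ) (u : Lp ℝ p (volume : Measure Plane)) :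
    distr p (c • u) = (c : ℂ) • distr p u := by
  have h : toC p (c • u) = (c : ℂ) • toC p u := by
    rw [map_smul]
    rfl
  simp only [distr, h, ← Lp.toTemperedDistributionCLM_apply, map_smul]

theorem distr_zero : distr p (0 : Lp ℝ p (volume : Measure Plane)) = 0 := by
  simp only [distr, map_zero, ← Lp.toTemperedDistributionCLM_apply]

theorem toTemperedDistribution_inj {f g : Lp ℂ p (volume : Measure Plane)}
    (h : Lp.toTemperedDistribution f = Lp.toTemperedDistribution g) : f = g := by
  have hk := Lp.ker_toTemperedDistributionCLM_eq_bot (F := ℂ) (μ := (volume : Measure Plane)) (p := p)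
  exact LinearMap.ker_eq_bot.mp hk h

theorem distr_inj {u v : Lp ℝ p (volume : Measure Plane)} (h : distr p u = distr p v) : u = v := by
  have h1 : toC p u = toC p v := toTemperedDistribution_inj h
  have hu := Complex.ofRealCLM.coeFn_compLp u
  have hv := Complex.ofRealCLM.coeFn_compLp v
  have h2 : Complex.ofRealCLM.compLp u = Complex.ofRealCLM.compLp v := h1
  rw [h2] at hu
  refine Lp.ext ?_
  filter_upwards [hu, hv] with z h3 h4
  have h5 : Complex.ofRealCLM (u z) = Complex.ofRealCLM (v z) := h3.symm.trans h4
  simpa using h5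

/-- The real functions `u ∈ H^s(ℝ²)` whose distributional derivatives `u_x, u_y` are in `L^∞`
(used for `s ≥ 0`, so that `H^s ⊆ L²`). -/
def XSubmodule (s : ℝ) : Submodule ℝ (Lp ℝ 2 (volume : Measure Plane)) where
  carrier := {u | TemperedDistribution.MemSobolev s 2 (distr 2 u) ∧
    ∀ i : Fin 2, ∃ g : Lp ℝ ∞ (volume : Measure Plane), ∂_{e i} (distr 2 u) = distr ∞ g}
  add_mem' := by
    rintro u v ⟨hu, hu'⟩ ⟨hv, hv'⟩
    refine ⟨by rw [distr_add]; exact hu.add hv, fun i => ?_⟩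
    obtain ⟨g, hg⟩ := hu' i
    obtain ⟨k, hk⟩ := hv' i
    exact ⟨g + k, by rw [distr_add, distr_add, LineDeriv.lineDerivOp_add, hg, hk]⟩
  zero_mem' := by
    refine ⟨by rw [distr_zero]; exact TemperedDistribution.memSobolev_fun_zero _ _ s 2,
      fun i => ⟨0, ?_⟩⟩
    rw [distr_zero, distr_zero]
    exact LineDeriv.lineDerivOp_zero ..
  smul_mem' := by
    rintro c u ⟨hu, hu'⟩
    refine ⟨by rw [distr_smul]; exact hu.smul c, fun i => ?_⟩
    obtain ⟨g, hg⟩ := hu' i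
    exact ⟨c • g, by rw [distr_smul, distr_smul, LineDeriv.lineDerivOp_smul, hg]⟩

/-- The space `X^s = {w ∈ H^s(ℝ²) ; w_x, w_y ∈ L^∞(ℝ²)}` of real functions. It is a type of its
own because it carries its own norm (see below) and not that of `L²`. -/
def X (s : ℝ) : Type := XSubmodule s

namespace X

variable {s : ℝ}

instance : AddCommGroup (X s) := inferInstanceAs (AddCommGroup (XSubmodule s))

instance : Module ℝ (X s) := inferInstanceAs (Module ℝ (XSubmodule s))

/-- The underlying `L²` function. -/
def toL2 : X s →ₗ[ℝ] Lp ℝ 2 (volume : Measure Plane) := (XSubmodule s).subtype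

theorem toL2_injective : Function.Injective (toL2 (s := s)) := Subtype.val_injective

/-- The `L²` function `(1 + |D|²)^{s/2} u`, whose `L²` norm is the `H^s` norm of `u`. -/
def bessel : X s →ₗ[ℝ] Lp ℂ 2 (volume : Measure Plane) where
  toFun u := u.2.1.choose
  map_add' u v := toTemperedDistribution_inj (by
    rw [← (u + v).2.1.choose_spec, ← Lp.toTemperedDistributionCLM_apply, map_add,
      Lp.toTemperedDistributionCLM_apply, Lp.toTemperedDistributionCLM_apply,
      ← u.2.1.choose_spec, ← v.2.1.choose_spec, ← map_add, ← distr_add]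
    rfl)
  map_smul' c u := toTemperedDistribution_inj (by
    have h : c • u.2.1.choose = (c : ℂ) • u.2.1.choose := rfl
    rw [RingHom.id_apply, h, ← (c • u).2.1.choose_spec, ← Lp.toTemperedDistributionCLM_apply,
      map_smul, Lp.toTemperedDistributionCLM_apply, ← u.2.1.choose_spec, ← map_smul, ← distr_smul]
    rfl)

theorem bessel_spec (u : X s) :
    TemperedDistribution.besselPotential Plane ℂ s (distr 2 (toL2 u)) =
      Lp.toTemperedDistribution (bessel u) :=
  u.2.1.choose_spec

/-- The distributional partial derivatives `∂u/∂x` (`i = 0`) and `∂u/∂y` (`i = 1`) of `u`,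
as `L^∞` functions. -/
def grad (i : Fin 2) : X s →ₗ[ℝ] Lp ℝ ∞ (volume : Measure Plane) where
  toFun u := (u.2.2 i).choose
  map_add' u v := distr_inj (by
    rw [← ((u + v).2.2 i).choose_spec, distr_add, ← (u.2.2 i).choose_spec,
      ← (v.2.2 i).choose_spec, ← LineDeriv.lineDerivOp_add, ← distr_add]
    rfl)
  map_smul' c u := distr_inj (by
    rw [RingHom.id_apply, ← ((c • u).2.2 i).choose_spec, distr_smul, ← (u.2.2 i).choose_spec,
      ← LineDeriv.lineDerivOp_smul, ← distr_smul]
    rfl)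

theorem grad_spec (i : Fin 2) (u : X s) :
    ∂_{e i} (distr 2 (toL2 u)) = distr ∞ (grad i u) :=
  (u.2.2 i).choose_spec

theorem bessel_injective : Function.Injective (bessel (s := s)) := by
  intro u v h
  apply toL2_injective
  apply distr_inj
  have h1 : TemperedDistribution.besselPotential Plane ℂ s (distr 2 (toL2 u)) =
      TemperedDistribution.besselPotential Plane ℂ s (distr 2 (toL2 v)) := by
    rw [bessel_spec, bessel_spec, h]
  have h2 := congrArg (TemperedDistribution.besselPotential Plane ℂ (-s)) h1
  simpa using h2

/-- The norm of `X^s`: `‖u‖_s + ‖u_x‖_∞ + ‖u_y‖_∞`. -/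
instance : Norm (X s) := ⟨fun u => ‖bessel u‖ + ‖grad 0 u‖ + ‖grad 1 u‖⟩

theorem norm_def (u : X s) : ‖u‖ = ‖bessel u‖ + ‖grad 0 u‖ + ‖grad 1 u‖ := rfl

theorem normedSpaceCore : NormedSpace.Core ℝ (X s) where
  norm_nonneg u := by rw [norm_def]; positivity
  norm_smul c u := by simp only [norm_def, map_smul, norm_smul]; ring
  norm_triangle u v := by
    simp only [norm_def, map_add]
    have h1 := norm_add_le (bessel u) (bessel v)
    have h2 := norm_add_le (grad 0 u) (grad 0 v)
    have h3 := norm_add_le (grad 1 u) (grad 1 v)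
    linarith
  norm_eq_zero_iff u := by
    refine ⟨fun h => ?_, fun h => by simp [h, norm_def]⟩
    rw [norm_def] at h
    have h1 := norm_nonneg (bessel u)
    have h2 := norm_nonneg (grad 0 u)
    have h3 := norm_nonneg (grad 1 u)
    have h4 : bessel u = 0 := norm_eq_zero.mp (by linarith)
    exact bessel_injective (by rw [h4, map_zero])

instance : NormedAddCommGroup (X s) := NormedAddCommGroup.ofCore normedSpaceCore

instance : NormedSpace ℝ (X s) := NormedSpace.ofCore normedSpaceCore

/-- `|∇u|² = u_x² + u_y²`. -/
def gradSq (u : X s) (z : Plane) : ℝ := ∑ i : Fin 2, (grad i u z) ^ 2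

end X

variable {s : ℝ}

/-- The Fourier transform `ξ ↦ ∫ e^{-2πi z·ξ} β(z) dz` of the kernel; its real part is taken since
it is real for the kernels considered. -/
def symbol (β : Plane → ℝ) (ξ : Plane) : ℝ := (𝓕 (fun z => (β z : ℂ)) ξ).re

/-- `β` is integrable and `0 ≤ β̂(ξ) ≤ C (1 + |ξ|²)^{-r/2}` for all `ξ`. -/
structure IsKernel (β : Plane → ℝ) (r : ℝ) : Prop where
  integrable : Integrable β
  real : ∀ ξ, (𝓕 (fun z => (β z : ℂ)) ξ).im = 0
  nonneg : ∀ ξ, 0 ≤ symbol β ξ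
  decay : ∃ C : ℝ, 0 < C ∧ ∀ ξ, symbol β ξ ≤ C * (1 + ‖ξ‖ ^ 2) ^ (-r / 2)

/-- The product `β̂^{-1/2} û`, for `u ∈ L²`. -/
def symbolMul (β : Plane → ℝ) (u : Lp ℝ 2 (volume : Measure Plane)) (ξ : Plane) : ℂ :=
  ((symbol β ξ ^ (-(1 / 2) : ℝ) : ℝ) : ℂ) * (𝓕 (toC 2 u) : Lp ℂ 2 (volume : Measure Plane)) ξ

/-- `R u ∈ L²`, that is, `β̂^{-1/2} û ∈ L²`. Where `β̂` vanishes `β̂^{-1/2}` is infinite, so that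
`û` has to vanish almost everywhere there. -/
def InDomR (β : Plane → ℝ) (u : Lp ℝ 2 (volume : Measure Plane)) : Prop :=
  (∀ᵐ ξ, symbol β ξ = 0 → (𝓕 (toC 2 u) : Lp ℂ 2 (volume : Measure Plane)) ξ = 0) ∧
    MemLp (symbolMul β u) 2 volume

open Classical in
/-- The unbounded operator `R u = 𝓕⁻¹(β̂^{-1/2} û)` on `L²` (with the value `0` outside its
domain). -/
def R (β : Plane → ℝ) (u : Lp ℝ 2 (volume : Measure Plane)) : Lp ℂ 2 (volume : Measure Plane) :=
  if h : InDomR β u then 𝓕⁻ (h.2.toLp (symbolMul β u)) else 0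

/-- The component `∂F/∂w_x = 2 w_x F'(|∇w|²)` (`i = 0`) or `∂F/∂w_y` (`i = 1`). -/
def flux (F : ℝ → ℝ) (w : X s) (i : Fin 2) (z : Plane) : ℝ :=
  2 * X.grad i w z * deriv F (w.gradSq z)

/-- `u = (β ∗ ∂F/∂w_x)_x + (β ∗ ∂F/∂w_y)_y`, the outer derivatives being taken in the sense of
tempered distributions. -/
def IsK (β : Plane → ℝ) (F : ℝ → ℝ) (w u : X s) : Prop :=
  ∀ η : 𝓢(Plane, ℂ), distr 2 (X.toL2 u) η =
    -∑ i : Fin 2, ∫ z, (((β ⋆[ContinuousLinearMap.mul ℝ ℝ, volume] flux F w i) z : ℝ) : ℂ) *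
      (∂_{e i} η) z

/-- The interval `[0, T)`, where `T = ∞` is allowed. -/
def timeInterval (T : EReal) : Set ℝ := {t | 0 ≤ t ∧ (t : EReal) < T}

/-- The velocity `w_t(t)`; it is the right derivative at `t = 0`. -/
def velocity (T : EReal) (w : ℝ → X s) (t : ℝ) : X s := derivWithin w (timeInterval T) t

/-- `w ∈ C²([0, T), X^s)` solves `w_tt = (β ∗ ∂F/∂w_x)_x + (β ∗ ∂F/∂w_y)_y` for `0 < t < T`, with
`w(0) = φ` and `w_t(0) = ψ`. -/
structure IsSolution (β : Plane → ℝ) (F : ℝ → ℝ) (φ ψ : X s) (T : EReal) (w : ℝ → X s) :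
    Prop where
  contDiffOn : ContDiffOn ℝ 2 w (timeInterval T)
  equation : ∀ t ∈ timeInterval T, 0 < t →
    IsK β F (w t) (iteratedDerivWithin 2 w (timeInterval T) t)
  init : w 0 = φ
  init_velocity : velocity T w 0 = ψ

/-- The energy `½ ‖R w_t(t)‖² + ∫ F(|∇w(t)|²)`. -/
def energy (β : Plane → ℝ) (F : ℝ → ℝ) (T : EReal) (w : ℝ → X s) (t : ℝ) : ℝ :=
  1 / 2 * ‖R β (X.toL2 (velocity T w t))‖ ^ 2 + ∫ z, F ((w t).gradSq z)

end NonlocalWave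

end

noncomputable section

namespace NonlocalWave

/-! Formally, pairing the equation with `R² w_t` gives the law: `½‖R w_t‖²` changes at the rate `Re
⟨R w_t, R w_tt⟩ = -Σ ∫ (∂F/∂w_i) ∂_i w_t`, which is minus the rate of change of `∫ F(|∇w|²)`. The
difficulty is that `R` is unbounded.

It is never differentiated through. Since `r ≥ 2`, `|ξ| β̂^{1/2}` is bounded, so `forcing = β̂^{1/2}
Σ 2πi ξ_i (∂F/∂w_i)^` is in `L²` and depends continuously on `w`. The equation says that the
transform of `w_tt` is `β̂^{1/2}` times `forcing` (`IsK.hatL2_eq_mulOp_forcing`). Writing `ψ̂ =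
β̂^{1/2} q` and setting `Q(t) = q + ∫₀ᵗ forcing`, integration in time gives `ŵ_t = β̂^{1/2} Q`
(`IsSolution.exists_primitive`). Hence `R w_t` is in `L²`, `‖R w_t‖ = ‖Q‖`, and `Q` is
differentiable in `L²`.

The potential energy is Fréchet differentiable on all of `X s` (`hasFDerivAt_potential`): gradients
lie in `L² ∩ L^∞` and `F` is `C²`, so the Taylor remainder is quadratic. Plancherel and the
imaginary symbol of `∂_i` make the two rates cancel (`re_inner_forcing`). -/

/-- The complex Hilbert space `L²(ℝ²)`. -/
abbrev L2C : Type := Lp ℂ 2 (volume : Measure Plane)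

theorem ae_eq_of_integral_schwartz_mul_eq {f g : Plane → ℂ} (hf : LocallyIntegrable f)
    (hg : LocallyIntegrable g)
    (h : ∀ η : 𝓢(Plane, ℂ), ∫ z, η z * f z = ∫ z, η z * g z) : f =ᵐ[volume] g := by
  refine ae_eq_of_integral_contDiff_smul_eq hf hg fun k k_smooth k_cpt => ?_
  have h1 : HasCompactSupport (Complex.ofRealCLM ∘ k) := k_cpt.comp_left rfl
  have h2 : ContDiff ℝ ∞ (Complex.ofRealCLM ∘ k) := by fun_prop
  simpa using h (h1.toSchwartzMap h2)

/-! ### Bounded multipliers on `L²` -/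

section Multiplication

variable {a b : Plane → ℂ}

/-- Multiplication by the bounded function `a` on `L²`. -/
def mulOp (ha : MemLp a ∞ volume) : L2C →L[ℂ] L2C :=
  (ContinuousLinearMap.mul ℂ ℂ).holderL volume ∞ 2 2 (ha.toLp a)

theorem coeFn_mulOp (ha : MemLp a ∞ volume) (f : L2C) :
    mulOp ha f =ᵐ[volume] fun ξ => a ξ * f ξ := by
  filter_upwards [(ContinuousLinearMap.mul ℂ ℂ).coeFn_holder (r := 2) (ha.toLp a) f,
    ha.coeFn_toLp] with ξ h1 h2
  rw [← h2]
  exact h1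

theorem toTemperedDistribution_mulOp (ha : MemLp a ∞ volume) (ha' : a.HasTemperateGrowth)
    (f : L2C) : Lp.toTemperedDistribution (mulOp ha f) =
      TemperedDistribution.smulLeftCLM ℂ a (Lp.toTemperedDistribution f) := by
  rw [← Lp.toTemperedDistribution_smul_eq (r := 2) ha' ha]
  congr 1

theorem inner_mulOp_left (ha : MemLp a ∞ volume) (f g : L2C) (hb : MemLp b ∞ volume)
    (hab : ∀ ξ, b ξ = starRingEnd ℂ (a ξ)) :
    inner ℂ (mulOp ha f) g = inner ℂ f (mulOp hb g) := by
  rw [L2.inner_def, L2.inner_def]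
  refine integral_congr_ae ?_
  filter_upwards [coeFn_mulOp ha f, coeFn_mulOp hb g] with ξ h1 h2
  rw [h1, h2, hab]
  simp only [RCLike.inner_apply, map_mul]
  ring

end Multiplication

theorem memLp_top_of_forall_norm_le {a : Plane → ℂ} (ha : Measurable a) {C : ℝ} (h : ∀ ξ, ‖a ξ‖ ≤ C) :
    MemLp a ∞ volume :=
  MeasureTheory.memLp_top_of_bound ha.aestronglyMeasurable C (Filter.Eventually.of_forall h)

variable {s : ℝ}

/-- The `L²` norm of a function dominated by a sum of two `L²` functions. -/
theorem norm_le_of_ae_le_mul_add {f g₀ g₁ : L2C} {K : ℝ} (hK : 0 ≤ K)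
    (h : ∀ᵐ z, ‖f z‖ ≤ K * (‖g₀ z‖ + ‖g₁ z‖)) : ‖f‖ ≤ K * (‖g₀‖ + ‖g₁‖) := by
  let n : L2C → Lp ℝ 2 (volume : Measure Plane) := fun g => (Lp.memLp g).norm.toLp _
  have hn : ∀ g : L2C, ‖n g‖ = ‖g‖ := fun g => by
    rw [Lp.norm_toLp, eLpNorm_norm, Lp.norm_def]
  have h1 : ‖f‖ ≤ K * ‖n g₀ + n g₁‖ := by
    refine Lp.norm_le_mul_norm_of_ae_le_mul ?_
    filter_upwards [h, Lp.coeFn_add (n g₀) (n g₁), (Lp.memLp g₀).norm.coeFn_toLp,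
      (Lp.memLp g₁).norm.coeFn_toLp] with z h1 h2 h3 h4
    rw [h2, Pi.add_apply, h3, h4, Real.norm_of_nonneg (by positivity)]
    exact h1
  refine h1.trans (mul_le_mul_of_nonneg_left ?_ hK)
  calc ‖n g₀ + n g₁‖ ≤ ‖n g₀‖ + ‖n g₁‖ := norm_add_le _ _
    _ = _ := by rw [hn, hn]

/-! ### Fourier transform and gradient of elements of `X^s` -/

/-- The weight `(1 + |ξ|²)^{-s/2}`. -/
def weight (s : ℝ) (ξ : Plane) : ℂ := (((1 + ‖ξ‖ ^ 2) ^ (-s / 2) : ℝ) : ℂ)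

/-- The symbol `2πi ξ_i` of `∂/∂x_i`. -/
def derivSymbol (i : Fin 2) (ξ : Plane) : ℂ := 2 * Real.pi * Complex.I * (inner ℝ ξ (e i) : ℝ)

theorem weight_temperate (s : ℝ) : (weight s).HasTemperateGrowth := by
  unfold weight; fun_prop

theorem inner_temperate (i : Fin 2) :
    (fun ξ : Plane => ((inner ℝ ξ (e i) : ℝ) : ℂ)).HasTemperateGrowth := by
  fun_prop

theorem derivSymbol_temperate (i : Fin 2) : (derivSymbol i).HasTemperateGrowth := by
  unfold derivSymbol
  have := inner_temperate i
  fun_prop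

theorem norm_weight (s : ℝ) (ξ : Plane) : ‖weight s ξ‖ = (1 + ‖ξ‖ ^ 2) ^ (-s / 2) := by
  rw [weight, Complex.norm_real, Real.norm_of_nonneg (by positivity)]

theorem norm_derivSymbol_le (i : Fin 2) (ξ : Plane) : ‖derivSymbol i ξ‖ ≤ 2 * Real.pi * ‖ξ‖ := by
  have h : |(inner ℝ ξ (e i) : ℝ)| ≤ ‖ξ‖ := by
    simpa using abs_real_inner_le_norm ξ (e i)
  rw [derivSymbol, norm_mul, Complex.norm_real, Real.norm_eq_abs]
  have h2 : ‖(2 * Real.pi * Complex.I : ℂ)‖ = 2 * Real.pi := by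
    simp [abs_of_pos Real.pi_pos]
  rw [h2]
  exact mul_le_mul_of_nonneg_left h (by positivity)

theorem weight_memLp (hs : 0 ≤ s) : MemLp (weight s) ∞ volume := by
  refine memLp_top_of_forall_norm_le (weight_temperate s).1.continuous.measurable (C := 1) fun ξ => ?_
  rw [norm_weight]
  exact Real.rpow_le_one_of_one_le_of_nonpos (by nlinarith [sq_nonneg ‖ξ‖]) (by linarith)

/-- One derivative costs a factor `|ξ| ≤ (1 + |ξ|²)^{1/2}`, absorbed by the weight because `s ≥ 1`.
-/
theorem derivSymbol_mul_weight_memLp (i : Fin 2) (hs : 1 ≤ s) :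
    MemLp (derivSymbol i * weight s) ∞ volume := by
  refine memLp_top_of_forall_norm_le ((derivSymbol_temperate i).mul
    (weight_temperate s)).1.continuous.measurable (C := 2 * Real.pi) fun ξ => ?_
  have h1 : (1:ℝ) ≤ 1 + ‖ξ‖ ^ 2 := by nlinarith [sq_nonneg ‖ξ‖]
  have h2 : (1 + ‖ξ‖ ^ 2) ^ (-s / 2) ≤ (1 + ‖ξ‖ ^ 2) ^ (-(1 / 2) : ℝ) :=
    Real.rpow_le_rpow_of_exponent_le h1 (by linarith)
  have h3 : ‖ξ‖ ≤ (1 + ‖ξ‖ ^ 2) ^ (1 / 2 : ℝ) := by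
    rw [← Real.sqrt_eq_rpow]
    exact Real.le_sqrt_of_sq_le (by linarith)
  have h4 : (1 + ‖ξ‖ ^ 2) ^ (1 / 2 : ℝ) * (1 + ‖ξ‖ ^ 2) ^ (-(1 / 2) : ℝ) = 1 := by
    rw [← Real.rpow_add (by linarith)]; simp
  rw [Pi.mul_apply, norm_mul, norm_weight]
  calc ‖derivSymbol i ξ‖ * (1 + ‖ξ‖ ^ 2) ^ (-s / 2)
      ≤ (2 * Real.pi * (1 + ‖ξ‖ ^ 2) ^ (1 / 2 : ℝ)) * (1 + ‖ξ‖ ^ 2) ^ (-(1 / 2) : ℝ) := by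
        refine mul_le_mul ((norm_derivSymbol_le i ξ).trans ?_) h2 (by positivity) (by positivity)
        exact mul_le_mul_of_nonneg_left h3 (by positivity)
    _ = 2 * Real.pi := by rw [mul_assoc, h4, mul_one]

/-- `X.bessel` as a continuous map. -/
def besselL : X s →L[ℝ] L2C :=
  LinearMap.mkContinuous X.bessel 1 fun u => by
    rw [one_mul, X.norm_def]
    linarith [norm_nonneg (X.grad 0 u), norm_nonneg (X.grad 1 u)]

/-- The Fourier transform of `L²` as a real-linear map. -/
def fourierL : L2C →L[ℝ] L2C := (fourierCLM ℂ L2C).restrictScalars ℝ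

/-- The Fourier transform of `u ∈ X^s`. -/
def hatL2 (hs : 0 ≤ s) : X s →L[ℝ] L2C :=
  ((mulOp (weight_memLp hs)).restrictScalars ℝ).comp (fourierL.comp besselL)

/-- Factoring the transform through `bessel` makes it continuous for the norm of `X s`; inverting
the Bessel potential shows that nothing else has changed. -/
theorem hatL2_eq (hs : 0 ≤ s) (u : X s) : hatL2 hs u = 𝓕 (toC 2 (X.toL2 u)) := by
  apply toTemperedDistribution_inj
  have h1 : distr 2 (X.toL2 u) = TemperedDistribution.besselPotential Plane ℂ (-s)
      (Lp.toTemperedDistribution (X.bessel u)) := by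
    rw [← X.bessel_spec]; simp
  have h2 : hatL2 hs u = mulOp (weight_memLp hs) (𝓕 (X.bessel u)) := rfl
  rw [← Lp.fourier_toTemperedDistribution_eq, h2,
    toTemperedDistribution_mulOp _ (weight_temperate s)]
  have h3 := congrArg (fun d : 𝓢'(Plane, ℂ) => 𝓕 d) h1
  simp only [TemperedDistribution.fourier_besselPotential_eq_smulLeftCLM_fourier_apply,
    Lp.fourier_toTemperedDistribution_eq] at h3
  exact h3.symm

/-- The partial derivatives of `u ∈ X^s`, as `L²` functions. -/
def gradL2 (hs : 1 ≤ s) (i : Fin 2) : X s →L[ℝ] L2C :=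
  ((fourierInvCLM ℂ L2C).restrictScalars ℝ).comp
    (((mulOp (derivSymbol_mul_weight_memLp i hs)).restrictScalars ℝ).comp (fourierL.comp besselL))

theorem fourier_gradL2 (hs : 1 ≤ s) (i : Fin 2) (u : X s) :
    𝓕 (gradL2 hs i u) = mulOp (derivSymbol_mul_weight_memLp i hs) (𝓕 (X.bessel u)) := by
  change 𝓕 (𝓕⁻ (mulOp (derivSymbol_mul_weight_memLp i hs) (𝓕 (X.bessel u)))) = _
  exact fourier_fourierInv_eq _

theorem coeFn_fourier_gradL2 (hs : 1 ≤ s) (i : Fin 2) (u : X s) :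
    (𝓕 (gradL2 hs i u) : L2C) =ᵐ[volume]
      fun ξ => derivSymbol i ξ * hatL2 (zero_le_one.trans hs) u ξ := by
  rw [fourier_gradL2]
  have h2 : hatL2 (zero_le_one.trans hs) u =
    mulOp (weight_memLp (zero_le_one.trans hs)) (𝓕 (X.bessel u)) := rfl
  rw [h2]
  filter_upwards [coeFn_mulOp (derivSymbol_mul_weight_memLp i hs) (𝓕 (X.bessel u)),
    coeFn_mulOp (weight_memLp (zero_le_one.trans hs)) (𝓕 (X.bessel u))] with ξ h3 h4
  rw [h3, h4, Pi.mul_apply, mul_assoc]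

theorem coeFn_toC {p : ℝ≥0∞} [Fact (1 ≤ p)] (u : Lp ℝ p (volume : Measure Plane)) :
    toC p u =ᵐ[volume] fun z => ((u z : ℝ) : ℂ) :=
  Complex.ofRealCLM.coeFn_compLpL u

/-- The derivative built in `L²` and the one given in `L^∞` have the same Fourier transform as
tempered distributions, so they agree almost everywhere. Gradients thus lie in `L² ∩ L^∞`. -/
theorem coeFn_gradL2 (hs : 1 ≤ s) (i : Fin 2) (u : X s) :
    gradL2 hs i u =ᵐ[volume] fun z => ((X.grad i u z : ℝ) : ℂ) := by
  have hs0 : 0 ≤ s := zero_le_one.trans hs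
  have key : Lp.toTemperedDistribution (gradL2 hs i u) = distr ∞ (X.grad i u) := by
    have h1 : 𝓕 (Lp.toTemperedDistribution (gradL2 hs i u)) = 𝓕 (distr ∞ (X.grad i u)) := by
      rw [← X.grad_spec, TemperedDistribution.fourier_lineDerivOp_eq, distr,
        Lp.fourier_toTemperedDistribution_eq, Lp.fourier_toTemperedDistribution_eq,
        fourier_gradL2, ← hatL2_eq hs0]
      have h2 : hatL2 hs0 u = mulOp (weight_memLp hs0) (𝓕 (X.bessel u)) := rfl
      rw [h2, toTemperedDistribution_mulOp _ (weight_temperate s),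
        toTemperedDistribution_mulOp _ ((derivSymbol_temperate i).mul (weight_temperate s)),
        TemperedDistribution.smulLeftCLM_smulLeftCLM_apply (weight_temperate s)
          (inner_temperate i), ← smul_apply,
        ← TemperedDistribution.smulLeftCLM_smul ((weight_temperate s).mul (inner_temperate i))]
      congr 2
      ext ξ
      simp only [Pi.mul_apply, Pi.smul_apply, derivSymbol, smul_eq_mul]
      ring
    have h3 := congrArg (fun d : 𝓢'(Plane, ℂ) => 𝓕⁻ d) h1
    simpa using h3
  have h4 : (gradL2 hs i u : Plane → ℂ) =ᵐ[volume] toC ∞ (X.grad i u) := by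
    refine ae_eq_of_integral_schwartz_mul_eq ((Lp.memLp _).locallyIntegrable (by norm_num))
      ((Lp.memLp _).locallyIntegrable (by norm_num)) fun η => ?_
    have h5 := congrArg (fun d : 𝓢'(Plane, ℂ) => d η) key
    simpa [distr] using h5
  exact h4.trans (coeFn_toC _)

/-! ### Taylor estimates for `p ↦ F(|p|²)` -/

section Density

variable {F : ℝ → ℝ}

theorem contDiff_density (hF : ContDiff ℝ 2 F) : ContDiff ℝ 2 fun p : Plane => F (‖p‖ ^ 2) :=
  hF.comp (contDiff_norm_sq ℝ)

theorem fderiv_density_apply (hF : ContDiff ℝ 2 F) (p v : Plane) :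
    fderiv ℝ (fun p : Plane => F (‖p‖ ^ 2)) p v = ∑ i : Fin 2, 2 * p i * deriv F (‖p‖ ^ 2) * v i := by
  have h1 := ((hF.differentiable (by norm_num)) (‖p‖ ^ 2)).hasDerivAt.comp_hasFDerivAt p
    (hasStrictFDerivAt_norm_sq p).hasFDerivAt
  have h2 : fderiv ℝ (fun p : Plane => F (‖p‖ ^ 2)) p = _ := h1.fderiv
  rw [h2]
  simp [PiLp.inner_apply]
  ring

/-- On bounded sets the gradient of `p ↦ F(|p|²)` is Lipschitz and the first-order Taylor remainder
is quadratic. -/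
theorem exists_density_bounds (hF : ContDiff ℝ 2 F) (K : ℝ) :
    ∃ L : ℝ, 0 ≤ L ∧ ∀ p q : Plane, ‖p‖ ≤ K → ‖q‖ ≤ K →
      ‖fderiv ℝ (fun p : Plane => F (‖p‖ ^ 2)) q - fderiv ℝ (fun p : Plane => F (‖p‖ ^ 2)) p‖
          ≤ L * ‖q - p‖ ∧
        |F (‖q‖ ^ 2) - F (‖p‖ ^ 2) - fderiv ℝ (fun p : Plane => F (‖p‖ ^ 2)) p (q - p)|
          ≤ L * ‖q - p‖ ^ 2 := by
  set Ψ : Plane → ℝ := fun p => F (‖p‖ ^ 2) with hΨdef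
  have hΨ : ContDiff ℝ 2 Ψ := contDiff_density hF
  have hD : ContDiff ℝ 1 (fderiv ℝ Ψ) := hΨ.fderiv_right (by norm_num)
  have hD2 : Continuous (fderiv ℝ (fderiv ℝ Ψ)) := hD.continuous_fderiv (by norm_num)
  obtain ⟨L, hL⟩ := (isCompact_closedBall (0 : Plane) K).exists_bound_of_continuousOn
    (f := fderiv ℝ (fderiv ℝ Ψ)) hD2.continuousOn
  have hconv := convex_closedBall (0 : Plane) K
  have hlip : ∀ p q : Plane, ‖p‖ ≤ K → ‖q‖ ≤ K →
      ‖fderiv ℝ Ψ q - fderiv ℝ Ψ p‖ ≤ max L 0 * ‖q - p‖ := fun p q hp hq =>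
    hconv.norm_image_sub_le_of_norm_fderiv_le
      (fun x _ => (hD.differentiable (by norm_num)) x)
      (fun x hx => (hL x hx).trans (le_max_left _ _)) (by simpa using hp) (by simpa using hq)
  refine ⟨max L 0, le_max_right _ _, fun p q hp hq => ⟨hlip p q hp hq, ?_⟩⟩
  have hseg : segment ℝ p q ⊆ Metric.closedBall (0 : Plane) K :=
    hconv.segment_subset (by simpa using hp) (by simpa using hq)
  -- On the segment the derivative differs from its value at `p` by at most `L * ‖q - p‖`; the mean
  -- value inequality supplies the second factor `‖q - p‖`.
  have h := (convex_segment p q).norm_image_sub_le_of_norm_fderiv_le' (f := Ψ) (𝕜 := ℝ)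
    (φ := fderiv ℝ Ψ p) (C := max L 0 * ‖q - p‖)
    (fun x _ => (hΨ.differentiable (by norm_num)) x)
    (fun x hx => (hlip p x hp (by simpa using hseg hx)).trans
      (mul_le_mul_of_nonneg_left (norm_sub_le_of_mem_segment hx) (le_max_right _ _)))
    (left_mem_segment ℝ p q) (right_mem_segment ℝ p q)
  rw [Real.norm_eq_abs] at h
  exact h.trans_eq (by ring)

end Density

/-! ### Pointwise gradient and flux -/

/-- The gradient `(u_x, u_y)`. -/
def gradVec (u : X s) (z : Plane) : Plane := WithLp.toLp 2 fun i => X.grad i u z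

theorem gradVec_apply (u : X s) (z : Plane) (i : Fin 2) : gradVec u z i = X.grad i u z := rfl

theorem norm_gradVec_sq (u : X s) (z : Plane) : ‖gradVec u z‖ ^ 2 = u.gradSq z := by
  rw [EuclideanSpace.norm_sq_eq]
  simp [X.gradSq, gradVec]

theorem norm_gradVec_le_add (u : X s) (z : Plane) :
    ‖gradVec u z‖ ≤ |X.grad 0 u z| + |X.grad 1 u z| := by
  refine abs_le_of_sq_le_sq' ?_ (by positivity) |>.2
  rw [norm_gradVec_sq, X.gradSq, Fin.sum_univ_two, add_sq, sq_abs, sq_abs]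
  nlinarith [mul_nonneg (abs_nonneg (X.grad 0 u z)) (abs_nonneg (X.grad 1 u z))]

theorem ae_abs_le_norm (g : Lp ℝ ∞ (volume : Measure Plane)) : ∀ᵐ z, |g z| ≤ ‖g‖ := by
  have h : ∀ᵐ z, ‖g z‖ₑ ≤ eLpNorm g ∞ volume := by
    rw [eLpNorm_exponent_top]; exact ae_le_eLpNormEssSup
  filter_upwards [h] with z hz
  rw [← Real.norm_eq_abs, Lp.norm_def, ← toReal_enorm]
  exact ENNReal.toReal_mono (Lp.eLpNorm_ne_top g) hz

/-- This confines gradient values to a ball, where `exists_density_bounds` applies. -/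
theorem ae_norm_gradVec_le (u : X s) : ∀ᵐ z, ‖gradVec u z‖ ≤ ‖u‖ := by
  filter_upwards [ae_abs_le_norm (X.grad 0 u), ae_abs_le_norm (X.grad 1 u)] with z h0 h1
  rw [X.norm_def]
  linarith [norm_gradVec_le_add u z, norm_nonneg (X.bessel u)]

theorem ae_gradVec_add (u v : X s) : ∀ᵐ z, gradVec (u + v) z = gradVec u z + gradVec v z := by
  have h : ∀ i, ∀ᵐ z, X.grad i (u + v) z = X.grad i u z + X.grad i v z := fun i => by
    rw [map_add]; exact Lp.coeFn_add _ _
  filter_upwards [ae_all_iff.2 h] with z hz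
  ext i
  exact hz i

theorem measurable_grad (u : X s) (i : Fin 2) : Measurable (X.grad i u) :=
  (Lp.stronglyMeasurable _).measurable

theorem measurable_gradSq (u : X s) : Measurable u.gradSq := by
  unfold X.gradSq
  exact Finset.measurable_sum _ fun i _ => (measurable_grad u i).pow_const 2

theorem measurable_flux {F : ℝ → ℝ} (hF : ContDiff ℝ 2 F) (u : X s) (i : Fin 2) :
    Measurable (flux F u i) :=
  ((measurable_grad u i).const_mul 2).mul
    ((hF.continuous_deriv (by norm_num)).measurable.comp (measurable_gradSq u))

theorem flux_eq_fderiv {F : ℝ → ℝ} (hF : ContDiff ℝ 2 F) (u : X s) (i : Fin 2) (z : Plane) :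
    flux F u i z = fderiv ℝ (fun p : Plane => F (‖p‖ ^ 2)) (gradVec u z) (e i) := by
  rw [fderiv_density_apply hF]
  fin_cases i <;> simp [flux, norm_gradVec_sq, gradVec_apply]

theorem fderiv_density_zero {F : ℝ → ℝ} (hF : ContDiff ℝ 2 F) :
    fderiv ℝ (fun p : Plane => F (‖p‖ ^ 2)) 0 = 0 := by
  ext v
  simp [fderiv_density_apply hF]

theorem norm_clm_e_le (A : Plane →L[ℝ] ℝ) (i : Fin 2) : |A (e i)| ≤ ‖A‖ := by
  simpa using A.le_opNorm (e i)

theorem exists_flux_le {F : ℝ → ℝ} (hF : ContDiff ℝ 2 F) (K : ℝ) :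
    ∃ L : ℝ, 0 ≤ L ∧ ∀ u : X s, ‖u‖ ≤ K → ∀ i, ∀ᵐ z, |flux F u i z| ≤ L * ‖gradVec u z‖ := by
  -- The radius is made nonnegative so that the ball contains the comparison point `0`, where the
  -- derivative of the density vanishes.
  obtain ⟨L, hL0, hL⟩ := exists_density_bounds hF (max K 0)
  refine ⟨L, hL0, fun u hu i => ?_⟩
  filter_upwards [ae_norm_gradVec_le u] with z hz
  have h := (hL 0 (gradVec u z) (by simp) (hz.trans (hu.trans (le_max_left _ _)))).1
  rw [fderiv_density_zero hF, sub_zero, sub_zero] at h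
  rw [flux_eq_fderiv hF]
  exact (norm_clm_e_le _ i).trans h

theorem flux_memLp (hs : 1 ≤ s) {F : ℝ → ℝ} (hF : ContDiff ℝ 2 F) (u : X s) (i : Fin 2) :
    MemLp (fun z => (flux F u i z : ℂ)) 2 volume := by
  obtain ⟨L, hL0, hL⟩ := exists_flux_le (s := s) hF ‖u‖
  refine MemLp.of_le_mul (c := L) ((Lp.memLp (gradL2 hs 0 u)).norm.add
    (Lp.memLp (gradL2 hs 1 u)).norm)
    (Complex.measurable_ofReal.comp (measurable_flux hF u i)).aestronglyMeasurable ?_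
  filter_upwards [hL u le_rfl i, coeFn_gradL2 hs 0 u, coeFn_gradL2 hs 1 u] with z hz h0 h1
  rw [Pi.add_apply, h0, h1, Complex.norm_real, Complex.norm_real, Complex.norm_real,
    Real.norm_of_nonneg (add_nonneg (norm_nonneg _) (norm_nonneg _))]
  exact hz.trans (mul_le_mul_of_nonneg_left (norm_gradVec_le_add u z) hL0)

theorem exists_flux_bound {F : ℝ → ℝ} (hF : ContDiff ℝ 2 F) (u : X s) (i : Fin 2) :
    ∃ C : ℝ, ∀ᵐ z, |flux F u i z| ≤ C := by
  obtain ⟨L, hL0, hL⟩ := exists_flux_le (s := s) hF ‖u‖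
  refine ⟨L * ‖u‖, ?_⟩
  filter_upwards [hL u le_rfl i, ae_norm_gradVec_le u] with z h1 h2
  exact h1.trans (mul_le_mul_of_nonneg_left h2 hL0)

/-- The flux `∂F/∂w_x`, `∂F/∂w_y` as an `L²` function. -/
def fluxL2 (hs : 1 ≤ s) {F : ℝ → ℝ} (hF : ContDiff ℝ 2 F) (i : Fin 2) (u : X s) : L2C :=
  (flux_memLp hs hF u i).toLp _

theorem coeFn_fluxL2 (hs : 1 ≤ s) {F : ℝ → ℝ} (hF : ContDiff ℝ 2 F) (i : Fin 2) (u : X s) :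
    fluxL2 hs hF i u =ᵐ[volume] fun z => ((flux F u i z : ℝ) : ℂ) :=
  (flux_memLp hs hF u i).coeFn_toLp

/-- The flux is locally Lipschitz: for `‖v - u‖ < 1` both gradients stay in the ball of radius `‖u‖
+ 1`, and there the flux difference is at most `L |∇(v - u)|`, whose `L²` norm is controlled by `‖v
- u‖`. -/
theorem continuous_fluxL2 (hs : 1 ≤ s) {F : ℝ → ℝ} (hF : ContDiff ℝ 2 F) (i : Fin 2) :
    Continuous (fluxL2 (s := s) hs hF i) := by
  rw [continuous_iff_continuousAt]
  intro u
  obtain ⟨L, hL0, hL⟩ := exists_density_bounds hF (‖u‖ + 1)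
  have key : ∀ v : X s, ‖v - u‖ < 1 → ‖fluxL2 hs hF i v - fluxL2 hs hF i u‖ ≤
      L * (‖gradL2 hs 0 (v - u)‖ + ‖gradL2 hs 1 (v - u)‖) := by
    intro v hv
    refine norm_le_of_ae_le_mul_add hL0 ?_
    have hv' : ‖v‖ ≤ ‖u‖ + 1 := by
      have := norm_le_norm_add_norm_sub' v u
      linarith [norm_sub_rev u v]
    filter_upwards [Lp.coeFn_sub (fluxL2 hs hF i v) (fluxL2 hs hF i u), coeFn_fluxL2 hs hF i v,
      coeFn_fluxL2 hs hF i u, coeFn_gradL2 hs 0 (v - u), coeFn_gradL2 hs 1 (v - u),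
      ae_norm_gradVec_le v, ae_norm_gradVec_le u, ae_gradVec_add u (v - u)]
      with z h1 h2 h3 h4 h5 h6 h7 h8
    rw [h1, Pi.sub_apply, h2, h3, h4, h5, ← Complex.ofReal_sub, Complex.norm_real,
      Complex.norm_real, Complex.norm_real, flux_eq_fderiv hF, flux_eq_fderiv hF,
      ← sub_apply]
    rw [add_sub_cancel] at h8
    have h9 := (hL (gradVec u z) (gradVec v z) (by linarith) (by linarith)).1
    refine ((norm_clm_e_le _ i).trans h9).trans (mul_le_mul_of_nonneg_left ?_ hL0)
    rw [h8, add_sub_cancel_left]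
    exact norm_gradVec_le_add _ z
  have hlim : Filter.Tendsto (fun v : X s =>
      L * (‖gradL2 hs 0 (v - u)‖ + ‖gradL2 hs 1 (v - u)‖)) (nhds u) (nhds 0) := by
    have hc : Continuous fun v : X s =>
      L * (‖gradL2 hs 0 (v - u)‖ + ‖gradL2 hs 1 (v - u)‖) := by fun_prop
    simpa using hc.tendsto u
  rw [ContinuousAt, tendsto_iff_norm_sub_tendsto_zero]
  refine squeeze_zero' (Filter.Eventually.of_forall fun _ => norm_nonneg _) ?_ hlim
  filter_upwards [Metric.ball_mem_nhds u one_pos] with v hv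
  exact key v (by simpa [dist_eq_norm] using hv)

/-! ### The potential energy and its derivative -/

theorem inner_of_ae_eq_ofReal {f g : L2C} {a b : Plane → ℝ}
    (hf : f =ᵐ[volume] fun z => (a z : ℂ)) (hg : g =ᵐ[volume] fun z => (b z : ℂ)) :
    Integrable (fun z => a z * b z) ∧ (inner ℂ f g).re = ∫ z, a z * b z := by
  have h : (fun z => inner ℂ (f z) (g z)) =ᵐ[volume] fun z => ((a z * b z : ℝ) : ℂ) := by
    filter_upwards [hf, hg] with z h1 h2
    rw [h1, h2]
    simp [mul_comm]
  refine ⟨?_, ?_⟩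
  · have h1 := ((L2.integrable_inner (𝕜 := ℂ) f g).congr h).re
    simpa using h1
  · rw [L2.inner_def, integral_congr_ae h, integral_complex_ofReal, Complex.ofReal_re]

theorem integrable_gradSq (hs : 1 ≤ s) (u : X s) :
    Integrable u.gradSq ∧ ∫ z, u.gradSq z = ∑ i : Fin 2, ‖gradL2 hs i u‖ ^ 2 := by
  have h : ∀ i : Fin 2, Integrable (fun z => X.grad i u z ^ 2) ∧
      ∫ z, X.grad i u z ^ 2 = ‖gradL2 hs i u‖ ^ 2 := fun i => by
    obtain ⟨h1, h2⟩ := inner_of_ae_eq_ofReal (coeFn_gradL2 hs i u) (coeFn_gradL2 hs i u)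
    simp only [← pow_two] at h1 h2
    refine ⟨h1, ?_⟩
    rw [← h2, inner_self_eq_norm_sq_to_K]
    norm_cast
  unfold X.gradSq
  refine ⟨integrable_finsetSum _ fun i _ => (h i).1, ?_⟩
  rw [integral_finsetSum _ fun i _ => (h i).1]
  exact Finset.sum_congr rfl fun i _ => (h i).2

/-- Both `p ↦ F(|p|²)` and its derivative vanish at `0`, so on bounded sets it is `O(|p|²)`, and
`|∇u|²` is integrable. -/
theorem integrable_density (hs : 1 ≤ s) {F : ℝ → ℝ} (hF : ContDiff ℝ 2 F) (hF0 : F 0 = 0)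
    (u : X s) : Integrable fun z => F (u.gradSq z) := by
  obtain ⟨L, hL0, hL⟩ := exists_density_bounds hF ‖u‖
  refine Integrable.mono' ((integrable_gradSq hs u).1.const_mul L)
    (hF.continuous.measurable.comp (measurable_gradSq u)).aestronglyMeasurable ?_
  filter_upwards [ae_norm_gradVec_le u] with z hz
  have h := (hL 0 (gradVec u z) (by simp) hz).2
  simpa [fderiv_density_zero hF, hF0, norm_gradVec_sq] using h

/-- The functional `v ↦ Re ⟨f, v⟩` on `L²`. -/
def reInner (f : L2C) : L2C →L[ℝ] ℝ :=
  Complex.reCLM.comp ((innerSL ℂ f).restrictScalars ℝ)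

theorem reInner_apply (f g : L2C) : reInner f g = (inner ℂ f g).re := rfl

/-- The pointwise Taylor remainder is at most `L |∇h|²`; integrated, it is `L Σ ‖∂_i h‖²`, hence
`O(‖h‖²)`. -/
theorem hasFDerivAt_potential (hs : 1 ≤ s) {F : ℝ → ℝ} (hF : ContDiff ℝ 2 F) (hF0 : F 0 = 0)
    (u : X s) : HasFDerivAt (fun v : X s => ∫ z, F (v.gradSq z))
      (∑ i : Fin 2, (reInner (fluxL2 hs hF i u)).comp (gradL2 hs i)) u := by
  obtain ⟨L, hL0, hL⟩ := exists_density_bounds hF (‖u‖ + 1)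
  rw [hasFDerivAt_iff_isLittleO_nhds_zero]
  refine Asymptotics.IsBigO.trans_isLittleO (g := fun h : X s => ‖h‖ ^ 2) ?_
    (Asymptotics.isLittleO_norm_pow_id one_lt_two)
  refine Asymptotics.IsBigO.of_bound (L * ∑ i : Fin 2, ‖gradL2 (s := s) hs i‖ ^ 2) ?_
  filter_upwards [Metric.ball_mem_nhds (0 : X s) one_pos] with h hh
  have hh' : ‖h‖ < 1 := by simpa using hh
  have hlin : ∀ i : Fin 2, Integrable (fun z => flux F u i z * X.grad i h z) ∧
      (inner ℂ (fluxL2 hs hF i u) (gradL2 hs i h)).re = ∫ z, flux F u i z * X.grad i h z :=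
    fun i => inner_of_ae_eq_ofReal (coeFn_fluxL2 hs hF i u) (coeFn_gradL2 hs i h)
  have hsum : Integrable (fun z => ∑ i : Fin 2, flux F u i z * X.grad i h z) :=
    integrable_finsetSum _ fun i _ => (hlin i).1
  have heq : (∫ z, F ((u + h).gradSq z)) - (∫ z, F (u.gradSq z)) -
      (∑ i : Fin 2, (reInner (fluxL2 hs hF i u)).comp (gradL2 hs i)) h =
      ∫ z, (F ((u + h).gradSq z) - F (u.gradSq z) - ∑ i : Fin 2, flux F u i z * X.grad i h z) := by
    have hdiff : Integrable fun z => F ((u + h).gradSq z) - F (u.gradSq z) :=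
      (integrable_density hs hF hF0 _).sub (integrable_density hs hF hF0 _)
    rw [integral_sub hdiff hsum,
      integral_sub (integrable_density hs hF hF0 _) (integrable_density hs hF hF0 _),
      integral_finsetSum _ fun i _ => (hlin i).1, sum_apply]
    simp only [ContinuousLinearMap.comp_apply, reInner_apply, (hlin _).2]
  have hbound : ‖∫ z, (F ((u + h).gradSq z) - F (u.gradSq z) -
      ∑ i : Fin 2, flux F u i z * X.grad i h z)‖ ≤ ∫ z, L * h.gradSq z := by
    refine norm_integral_le_of_norm_le ((integrable_gradSq hs h).1.const_mul L) ?_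
    filter_upwards [ae_norm_gradVec_le u, ae_norm_gradVec_le (u + h), ae_gradVec_add u h]
      with z h1 h2 h3
    have h4 := (hL (gradVec u z) (gradVec (u + h) z) (by linarith)
      (by linarith [norm_add_le u h])).2
    rw [norm_gradVec_sq, norm_gradVec_sq, fderiv_density_apply hF] at h4
    rw [h3, add_sub_cancel_left, norm_gradVec_sq] at h4
    simp only [gradVec_apply, norm_gradVec_sq] at h4
    exact h4
  rw [heq]
  refine hbound.trans ?_
  rw [integral_const_mul, (integrable_gradSq hs h).2, norm_pow, norm_norm, mul_assoc,
    Finset.sum_mul]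
  refine mul_le_mul_of_nonneg_left (Finset.sum_le_sum fun i _ => ?_) hL0
  rw [← mul_pow]
  exact pow_le_pow_left₀ (norm_nonneg _) ((gradL2 hs i).le_opNorm h) 2

/-! ### The convolution theorem in weak form -/

section Convolution

theorem integral_fourier_mul_L2 (f : L2C) (χ : 𝓢(Plane, ℂ)) :
    ∫ z, (𝓕 χ) z * f z = ∫ ξ, χ ξ * (𝓕 f : L2C) ξ := by
  have h := congrArg (fun d : 𝓢'(Plane, ℂ) => d χ) (Lp.fourier_toTemperedDistribution_eq f)
  simpa using h

theorem integrable_schwartz_mul (ζ : 𝓢(Plane, ℂ)) (f : L2C) : Integrable fun ξ => ζ ξ * f ξ :=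
  (ζ.memLp 2 volume).integrable_mul (Lp.memLp f)

/-- Translations of `𝓕 ζ` pair with `f ∈ L²` as the Fourier transform of `ζ · 𝓕 f`. -/
theorem integral_fourier_translate_mul (f : L2C) (ζ : 𝓢(Plane, ℂ)) (t : Plane) :
    ∫ z, (𝓕 ζ) (z + t) * f z = 𝓕 (fun ξ => ζ ξ * (𝓕 f : L2C) ξ) t := by
  let θ : 𝓢(Plane, ℂ) := SchwartzMap.compSubConstCLM ℂ (-t) (𝓕 ζ)
  have hθ : ∀ z, θ z = (𝓕 ζ) (z + t) := fun z => by
    rw [← sub_neg_eq_add]; rfl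
  -- Translating `𝓕 ζ` by `t` multiplies its inverse transform by a character, which then supplies
  -- the kernel of the outer Fourier integral.
  have hζ : ∀ ξ, (𝓕⁻ θ) ξ = Real.fourierChar (-inner ℝ ξ t) • ζ ξ := fun ξ => by
    have h0 : ζ ξ = ∫ v, Real.fourierChar (inner ℝ v ξ) • (𝓕 ζ) v := by
      rw [← Real.fourierInv_eq, ← SchwartzMap.fourierInv_coe, fourierInv_fourier_eq]
    have h1 : ∫ v, Real.fourierChar (inner ℝ v ξ) • (𝓕 ζ) v =
        ∫ v, Real.fourierChar (inner ℝ (v + t) ξ) • (𝓕 ζ) (v + t) :=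
      (integral_add_right_eq_self (μ := volume)
        (fun v : Plane => (Real.fourierChar (inner ℝ v ξ) • (𝓕 ζ) v : ℂ)) t).symm
    rw [SchwartzMap.fourierInv_coe, Real.fourierInv_eq, h0, h1]
    simp only [Circle.smul_def]
    rw [← integral_smul]
    refine integral_congr_ae (Filter.Eventually.of_forall fun v => ?_)
    simp only [hθ]
    rw [smul_smul, ← Circle.coe_mul, ← AddChar.map_add_eq_mul, inner_add_left,
      real_inner_comm t ξ]
    congr 4
    ring
  have h1 := integral_fourier_mul_L2 f (𝓕⁻ θ)
  rw [fourier_fourierInv_eq] at h1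
  simp only [hθ, hζ] at h1
  rw [h1, Real.fourier_eq]
  simp only [smul_mul_assoc]

/-- Fubini, with integrand dominated by `C |θ(z) β(t)|`, followed by the shift `z ↦ z + t`. -/
theorem integral_convolution_mul {β g : Plane → ℝ} (hβ : Integrable β) (hg : Measurable g)
    {C : ℝ} (hC : ∀ᵐ z, |g z| ≤ C) {θ : Plane → ℂ} (hθ : Integrable θ) :
    ∫ z, (((β ⋆[ContinuousLinearMap.mul ℝ ℝ, volume] g) z : ℝ) : ℂ) * θ z =
      ∫ t, (β t : ℂ) * ∫ z, θ (z + t) * (g z : ℂ) := by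
  have h1 : ∀ z, (((β ⋆[ContinuousLinearMap.mul ℝ ℝ, volume] g) z : ℝ) : ℂ) * θ z =
      ∫ t, (g (z - t) : ℂ) * (θ z * (β t : ℂ)) := fun z => by
    rw [convolution, ← integral_complex_ofReal, ← integral_mul_const]
    refine integral_congr_ae (Filter.Eventually.of_forall fun t => ?_)
    simp only [ContinuousLinearMap.mul_apply', Complex.ofReal_mul]
    ring
  have h2 : Integrable (fun p : Plane × Plane => (g (p.1 - p.2) : ℂ) * (θ p.1 * (β p.2 : ℂ)))
      (volume.prod volume) := by
    refine (hθ.mul_prod hβ.ofReal).bdd_mul (c := C) (Complex.measurable_ofReal.comp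
      (hg.comp (measurable_fst.sub measurable_snd))).aestronglyMeasurable ?_
    -- The bound on `g` holds only almost everywhere; it transfers to the product because `(z, t) ↦
    -- z - t` pulls null sets back to null sets.
    filter_upwards [(quasiMeasurePreserving_sub_of_right_invariant
      (volume : Measure Plane) (volume : Measure Plane)).ae hC] with p hp
    simpa using hp
  simp_rw [h1]
  rw [integral_integral_swap h2]
  refine integral_congr_ae (Filter.Eventually.of_forall fun t => ?_)
  simp only
  rw [← integral_const_mul, ← integral_add_right_eq_self _ t]
  refine integral_congr_ae (Filter.Eventually.of_forall fun z => ?_)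
  simp only [add_sub_cancel_right]
  ring

variable {β : Plane → ℝ} {r : ℝ}

theorem IsKernel.fourier_eq (hβ : IsKernel β r) (ξ : Plane) :
    𝓕 (fun z => (β z : ℂ)) ξ = (symbol β ξ : ℂ) := by
  apply Complex.ext
  · simp [symbol]
  · simp [hβ.real ξ]

/-- The translations are moved onto the test function, leaving `β` paired with the Fourier transform
of the integrable function `ζ · 𝓕 f`. The Fourier integral is then moved across onto `β`, both
factors being in `L¹`. -/
theorem IsKernel.integral_convolution_fourier (hβ : IsKernel β r) {g : Plane → ℝ}
    (hg : Measurable g) {C : ℝ} (hC : ∀ᵐ z, |g z| ≤ C) {f : L2C}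
    (hf : f =ᵐ[volume] fun z => (g z : ℂ)) (ζ : 𝓢(Plane, ℂ)) :
    ∫ z, (((β ⋆[ContinuousLinearMap.mul ℝ ℝ, volume] g) z : ℝ) : ℂ) * (𝓕 ζ) z =
      ∫ ξ, ζ ξ * ((symbol β ξ : ℂ) * (𝓕 f : L2C) ξ) := by
  rw [integral_convolution_mul hβ.integrable hg hC (𝓕 ζ).integrable]
  have h1 : ∀ t : Plane, ∫ z, (𝓕 ζ) (z + t) * (g z : ℂ) =
      𝓕 (fun ξ => ζ ξ * (𝓕 f : L2C) ξ) t := fun t => by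
    rw [← integral_fourier_translate_mul]
    refine integral_congr_ae ?_
    filter_upwards [hf] with z hz
    rw [hz]
  simp_rw [h1]
  have h2 := VectorFourier.integral_fourierIntegral_smul_eq_flip (L := innerₗ Plane)
    (μ := volume) (ν := volume) Real.continuous_fourierChar continuous_inner
    (hβ.integrable.ofReal (𝕜 := ℂ)) (integrable_schwartz_mul ζ (𝓕 f))
  simp only [flip_innerₗ] at h2
  have h3 : ∫ ξ, 𝓕 (fun z => (β z : ℂ)) ξ • (ζ ξ * (𝓕 f : L2C) ξ) =
    ∫ t, (β t : ℂ) • 𝓕 (fun ξ => ζ ξ * (𝓕 f : L2C) ξ) t := h2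
  simp only [smul_eq_mul] at h3
  rw [← h3]
  refine integral_congr_ae (Filter.Eventually.of_forall fun ξ => ?_)
  simp only [hβ.fourier_eq]
  ring

end Convolution

/-! ### The square root of the symbol and the forcing -/

section Symbol

variable {β : Plane → ℝ} {r : ℝ}

theorem IsKernel.measurable_symbol (hβ : IsKernel β r) : Measurable (symbol β) := by
  have h : Continuous (𝓕 fun z => (β z : ℂ)) :=
    VectorFourier.fourierIntegral_continuous Real.continuous_fourierChar
      (L := innerₗ Plane) continuous_inner (hβ.integrable.ofReal (𝕜 := ℂ))
  exact (Complex.continuous_re.comp h).measurable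

/-- `β̂^{1/2}`. -/
def sqrtSymbol (β : Plane → ℝ) (ξ : Plane) : ℂ := (Real.sqrt (symbol β ξ) : ℂ)

theorem norm_sqrtSymbol (ξ : Plane) : ‖sqrtSymbol β ξ‖ = Real.sqrt (symbol β ξ) := by
  rw [sqrtSymbol, Complex.norm_real, Real.norm_of_nonneg (Real.sqrt_nonneg _)]

theorem IsKernel.sqrtSymbol_mul_self (hβ : IsKernel β r) (ξ : Plane) :
    sqrtSymbol β ξ * sqrtSymbol β ξ = (symbol β ξ : ℂ) := by
  rw [sqrtSymbol, ← Complex.ofReal_mul, Real.mul_self_sqrt (hβ.nonneg ξ)]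

theorem IsKernel.measurable_sqrtSymbol (hβ : IsKernel β r) : Measurable (sqrtSymbol β) :=
  Complex.measurable_ofReal.comp hβ.measurable_symbol.sqrt

/-- As `r ≥ 2`, `(1 + |ξ|²) β̂` is bounded: the factor `β̂^{1/2}` compensates one derivative. -/
theorem IsKernel.exists_sqrtSymbol_le (hβ : IsKernel β r) (hr : 2 ≤ r) :
    ∃ C : ℝ, 0 ≤ C ∧ ∀ ξ, Real.sqrt (1 + ‖ξ‖ ^ 2) * Real.sqrt (symbol β ξ) ≤ C := by
  obtain ⟨C, hC0, hC⟩ := hβ.decay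
  refine ⟨Real.sqrt C, Real.sqrt_nonneg _, fun ξ => ?_⟩
  have h1 : (1:ℝ) ≤ 1 + ‖ξ‖ ^ 2 := by nlinarith [sq_nonneg ‖ξ‖]
  rw [← Real.sqrt_mul (by linarith)]
  refine Real.sqrt_le_sqrt ?_
  have h2 : (1 + ‖ξ‖ ^ 2) ^ (-r / 2) ≤ (1 + ‖ξ‖ ^ 2)⁻¹ := by
    rw [← Real.rpow_neg_one]
    exact Real.rpow_le_rpow_of_exponent_le h1 (by linarith)
  calc (1 + ‖ξ‖ ^ 2) * symbol β ξ ≤ (1 + ‖ξ‖ ^ 2) * (C * (1 + ‖ξ‖ ^ 2)⁻¹) :=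
        mul_le_mul_of_nonneg_left ((hC ξ).trans (mul_le_mul_of_nonneg_left h2 hC0.le))
          (by linarith)
    _ = C := by field_simp

theorem IsKernel.sqrtSymbol_memLp (hβ : IsKernel β r) (hr : 2 ≤ r) :
    MemLp (sqrtSymbol β) ∞ volume := by
  obtain ⟨C, hC0, hC⟩ := hβ.exists_sqrtSymbol_le hr
  refine memLp_top_of_forall_norm_le hβ.measurable_sqrtSymbol (C := C) fun ξ => ?_
  rw [norm_sqrtSymbol]
  have h1 : 1 ≤ Real.sqrt (1 + ‖ξ‖ ^ 2) := Real.one_le_sqrt.2 (by nlinarith [sq_nonneg ‖ξ‖])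
  nlinarith [hC ξ, Real.sqrt_nonneg (symbol β ξ)]

theorem IsKernel.derivSymbol_mul_sqrtSymbol_memLp (hβ : IsKernel β r) (hr : 2 ≤ r) (i : Fin 2) :
    MemLp (derivSymbol i * sqrtSymbol β) ∞ volume := by
  obtain ⟨C, hC0, hC⟩ := hβ.exists_sqrtSymbol_le hr
  refine memLp_top_of_forall_norm_le ((derivSymbol_temperate i).1.continuous.measurable.mul
    hβ.measurable_sqrtSymbol) (C := 2 * Real.pi * C) fun ξ => ?_
  have h1 : ‖ξ‖ ≤ Real.sqrt (1 + ‖ξ‖ ^ 2) := Real.le_sqrt_of_sq_le (by linarith)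
  rw [Pi.mul_apply, norm_mul, norm_sqrtSymbol]
  calc ‖derivSymbol i ξ‖ * Real.sqrt (symbol β ξ)
      ≤ (2 * Real.pi * Real.sqrt (1 + ‖ξ‖ ^ 2)) * Real.sqrt (symbol β ξ) := by
        refine mul_le_mul_of_nonneg_right ((norm_derivSymbol_le i ξ).trans ?_)
          (Real.sqrt_nonneg _)
        exact mul_le_mul_of_nonneg_left h1 (by positivity)
    _ = 2 * Real.pi * (Real.sqrt (1 + ‖ξ‖ ^ 2) * Real.sqrt (symbol β ξ)) := by ring
    _ ≤ 2 * Real.pi * C := mul_le_mul_of_nonneg_left (hC ξ) (by positivity)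

/-- `β̂^{1/2} Σ 2πi ξ_i (∂F/∂w_i)^`, that is, `(R w_tt)^` for a solution `w`. -/
def forcing (hs : 1 ≤ s) {F : ℝ → ℝ} (hF : ContDiff ℝ 2 F) (hβ : IsKernel β r) (hr : 2 ≤ r)
    (w : X s) : L2C :=
  ∑ i : Fin 2, mulOp (hβ.derivSymbol_mul_sqrtSymbol_memLp hr i) (𝓕 (fluxL2 hs hF i w))

theorem continuous_forcing (hs : 1 ≤ s) {F : ℝ → ℝ} (hF : ContDiff ℝ 2 F) (hβ : IsKernel β r)
    (hr : 2 ≤ r) : Continuous (forcing (s := s) hs hF hβ hr) := by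
  unfold forcing
  refine continuous_finsetSum _ fun i _ => ?_
  exact (mulOp _).continuous.comp (fourierL.continuous.comp (continuous_fluxL2 hs hF i))

theorem coeFn_forcing (hs : 1 ≤ s) {F : ℝ → ℝ} (hF : ContDiff ℝ 2 F) (hβ : IsKernel β r)
    (hr : 2 ≤ r) (w : X s) : forcing hs hF hβ hr w =ᵐ[volume] fun ξ =>
      sqrtSymbol β ξ * ∑ i : Fin 2, derivSymbol i ξ * (𝓕 (fluxL2 hs hF i w) : L2C) ξ := by
  unfold forcing
  rw [Fin.sum_univ_two]
  filter_upwards [Lp.coeFn_add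
    (mulOp (hβ.derivSymbol_mul_sqrtSymbol_memLp hr 0) (𝓕 (fluxL2 hs hF 0 w)))
    (mulOp (hβ.derivSymbol_mul_sqrtSymbol_memLp hr 1) (𝓕 (fluxL2 hs hF 1 w))),
    coeFn_mulOp (hβ.derivSymbol_mul_sqrtSymbol_memLp hr 0) (𝓕 (fluxL2 hs hF 0 w)),
    coeFn_mulOp (hβ.derivSymbol_mul_sqrtSymbol_memLp hr 1) (𝓕 (fluxL2 hs hF 1 w))] with ξ h0 h1 h2
  rw [h0, Pi.add_apply, h1, h2, Fin.sum_univ_two, Pi.mul_apply, Pi.mul_apply]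
  ring

/-- The weak equation is tested on `𝓕 χ`. Its derivative is the transform of `-2πi ξ_i χ`, whose
sign cancels the minus in `IsK`, and `β̂` is split into two square roots, one of which goes into
`forcing`. -/
theorem IsK.hatL2_eq_mulOp_forcing (hs : 1 ≤ s) {F : ℝ → ℝ} (hF : ContDiff ℝ 2 F)
    (hβ : IsKernel β r) (hr : 2 ≤ r) {w u : X s} (h : IsK β F w u) :
    hatL2 (zero_le_one.trans hs) u =
      mulOp (hβ.sqrtSymbol_memLp hr) (forcing hs hF hβ hr w) := by
  refine Lp.ext (ae_eq_of_integral_schwartz_mul_eq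
    ((Lp.memLp _).locallyIntegrable (by norm_num))
    ((Lp.memLp _).locallyIntegrable (by norm_num)) fun χ => ?_)
  rw [hatL2_eq, ← integral_fourier_mul_L2]
  have h1 : ∫ z, (𝓕 χ) z * toC 2 (X.toL2 u) z = distr 2 (X.toL2 u) (𝓕 χ) := by
    simp [distr]
  rw [h1, h]
  have h2 : ∀ i : Fin 2, ∂_{e i} (𝓕 χ) =
      𝓕 (-(2 * Real.pi * Complex.I) • SchwartzMap.smulLeftCLM ℂ (inner ℝ · (e i)) χ) := fun i =>
    SchwartzMap.lineDerivOp_fourier_eq χ (e i)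
  have hint : ∀ i : Fin 2, Integrable fun ξ => χ ξ * (sqrtSymbol β ξ * ((derivSymbol i ξ *
      sqrtSymbol β ξ) * (𝓕 (fluxL2 hs hF i w) : L2C) ξ)) := fun i => by
    refine (integrable_schwartz_mul χ (mulOp (hβ.sqrtSymbol_memLp hr)
      (mulOp (hβ.derivSymbol_mul_sqrtSymbol_memLp hr i) (𝓕 (fluxL2 hs hF i w))))).congr ?_
    filter_upwards [coeFn_mulOp (hβ.sqrtSymbol_memLp hr)
      (mulOp (hβ.derivSymbol_mul_sqrtSymbol_memLp hr i) (𝓕 (fluxL2 hs hF i w))),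
      coeFn_mulOp (hβ.derivSymbol_mul_sqrtSymbol_memLp hr i) (𝓕 (fluxL2 hs hF i w))] with ξ h3 h4
    rw [h3, h4, Pi.mul_apply]
  have h3 : ∀ i : Fin 2, ∫ z, (((β ⋆[ContinuousLinearMap.mul ℝ ℝ, volume] flux F w i) z : ℝ) : ℂ)
      * (∂_{e i} (𝓕 χ)) z = -∫ ξ, χ ξ * (sqrtSymbol β ξ * ((derivSymbol i ξ *
      sqrtSymbol β ξ) * (𝓕 (fluxL2 hs hF i w) : L2C) ξ)) := fun i => by
    obtain ⟨C, hC⟩ := exists_flux_bound hF w i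
    rw [h2, hβ.integral_convolution_fourier (measurable_flux hF w i) hC (coeFn_fluxL2 hs hF i w),
      ← integral_neg]
    refine integral_congr_ae (Filter.Eventually.of_forall fun ξ => ?_)
    have h4 : (fun z : Plane => inner ℝ z (e i)).HasTemperateGrowth := by fun_prop
    simp only [← hβ.sqrtSymbol_mul_self, smul_apply,
      SchwartzMap.smulLeftCLM_apply_apply h4, derivSymbol, smul_eq_mul, Complex.real_smul]
    ring
  simp_rw [h3]
  rw [Finset.sum_neg_distrib, neg_neg, ← integral_finsetSum _ fun i _ => hint i]
  refine integral_congr_ae ?_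
  filter_upwards [coeFn_mulOp (hβ.sqrtSymbol_memLp hr) (forcing hs hF hβ hr w),
    coeFn_forcing hs hF hβ hr w] with ξ h5 h6
  rw [h5, h6, Fin.sum_univ_two, Fin.sum_univ_two]
  ring

end Symbol

variable {r : ℝ} {β : Plane → ℝ}

/-! ### The time interval -/

section TimeInterval

variable {T : EReal}

theorem isOpen_setOf_coe_lt (T : EReal) : IsOpen {t : ℝ | (t : EReal) < T} :=
  isOpen_lt continuous_coe_real_ereal continuous_const

theorem uniqueDiffOn_timeInterval (T : EReal) : UniqueDiffOn ℝ (timeInterval T) :=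
  (uniqueDiffOn_Ici (0 : ℝ)).inter (isOpen_setOf_coe_lt T)

theorem timeInterval_mem_nhdsGE {t : ℝ} (ht : t ∈ timeInterval T) :
    timeInterval T ∈ nhdsWithin t (Ici t) :=
  Filter.inter_mem (Filter.mem_of_superset self_mem_nhdsWithin (Ici_subset_Ici.2 ht.1))
    (nhdsWithin_le_nhds ((isOpen_setOf_coe_lt T).mem_nhds ht.2))

theorem Icc_subset_timeInterval {b : ℝ} (hb : b ∈ timeInterval T) :
    Icc 0 b ⊆ timeInterval T := fun _ ht =>
  ⟨ht.1, (EReal.coe_le_coe_iff.2 ht.2).trans_lt hb.2⟩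

end TimeInterval

/-! ### The operator `R` and the power balance -/

section Operator

/-- At zeros of `β̂` the real power and the inverse both take the value `0`, so no exception is
needed. -/
theorem symbolMul_eq (u : Lp ℝ 2 (volume : Measure Plane)) (hβ : IsKernel β r) (ξ : Plane) :
    symbolMul β u ξ = (sqrtSymbol β ξ)⁻¹ * (𝓕 (toC 2 u) : L2C) ξ := by
  rw [symbolMul, sqrtSymbol, Real.rpow_neg (hβ.nonneg ξ), ← Real.sqrt_eq_rpow, Complex.ofReal_inv]

theorem IsKernel.sqrtSymbol_eq_zero_iff (hβ : IsKernel β r) (ξ : Plane) :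
    sqrtSymbol β ξ = 0 ↔ symbol β ξ = 0 := by
  rw [sqrtSymbol, Complex.ofReal_eq_zero, Real.sqrt_eq_zero (hβ.nonneg ξ)]

/-- The indicator of `{β̂ ≠ 0}`. -/
def symbolSupport (β : Plane → ℝ) (ξ : Plane) : ℂ := sqrtSymbol β ξ * (sqrtSymbol β ξ)⁻¹

theorem symbolSupport_mul (ξ : Plane) : symbolSupport β ξ * sqrtSymbol β ξ = sqrtSymbol β ξ := by
  rw [symbolSupport, mul_assoc]
  rcases eq_or_ne (sqrtSymbol β ξ) 0 with h | h <;> simp [h]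

theorem symbolSupport_mul_inv (ξ : Plane) :
    symbolSupport β ξ * (sqrtSymbol β ξ)⁻¹ = (sqrtSymbol β ξ)⁻¹ := by
  rw [symbolSupport]
  rcases eq_or_ne (sqrtSymbol β ξ) 0 with h | h <;> simp [h]

theorem IsKernel.symbolSupport_memLp (hβ : IsKernel β r) : MemLp (symbolSupport β) ∞ volume := by
  refine memLp_top_of_forall_norm_le (hβ.measurable_sqrtSymbol.mul hβ.measurable_sqrtSymbol.inv)
    (C := 1) fun ξ => ?_
  rw [symbolSupport]
  rcases eq_or_ne (sqrtSymbol β ξ) 0 with h | h <;> simp [h]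

/-- If `û = β̂^{1/2} q` with `q ∈ L²` supported in `{β̂ ≠ 0}`, then `R u = 𝓕⁻ q`. -/
theorem IsKernel.inDomR_of_eq (hβ : IsKernel β r) (hr : 2 ≤ r)
    {u : Lp ℝ 2 (volume : Measure Plane)} {q : L2C}
    (hq : mulOp hβ.symbolSupport_memLp q = q)
    (hu : 𝓕 (toC 2 u) = mulOp (hβ.sqrtSymbol_memLp hr) q) :
    InDomR β u ∧ ‖R β u‖ = ‖q‖ := by
  have h1 := coeFn_mulOp (hβ.sqrtSymbol_memLp hr) q
  rw [← hu] at h1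
  have h2 := coeFn_mulOp hβ.symbolSupport_memLp q
  rw [hq] at h2
  have h3 : symbolMul β u =ᵐ[volume] q := by
    filter_upwards [h1, h2] with ξ h4 h5
    rw [symbolMul_eq u hβ, h4, h5, symbolSupport]
    ring_nf
    rcases eq_or_ne (sqrtSymbol β ξ) 0 with h | h <;> field_simp
  have hdom : InDomR β u := by
    refine ⟨?_, (memLp_congr_ae h3).2 (Lp.memLp q)⟩
    filter_upwards [h1] with ξ h4 h5
    rw [h4, (hβ.sqrtSymbol_eq_zero_iff ξ).2 h5, zero_mul]
  refine ⟨hdom, ?_⟩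
  have h6 : hdom.2.toLp (symbolMul β u) = q :=
    Lp.ext (hdom.2.coeFn_toLp.trans h3)
  rw [R, dif_pos hdom, h6, ← Lp.norm_fourier_eq, fourier_fourierInv_eq]

/-- Here `q = β̂^{-1/2} û`. The first clause of `InDomR` is what recovers `û` on `{β̂ = 0}`. -/
theorem IsKernel.exists_of_inDomR (hβ : IsKernel β r) (hr : 2 ≤ r)
    {u : Lp ℝ 2 (volume : Measure Plane)} (h : InDomR β u) :
    ∃ q : L2C, mulOp hβ.symbolSupport_memLp q = q ∧
      𝓕 (toC 2 u) = mulOp (hβ.sqrtSymbol_memLp hr) q := by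
  refine ⟨h.2.toLp _, Lp.ext ?_, Lp.ext ?_⟩
  · filter_upwards [coeFn_mulOp hβ.symbolSupport_memLp (h.2.toLp _), h.2.coeFn_toLp] with ξ h1 h2
    rw [h1, h2, symbolMul_eq u hβ, ← mul_assoc, symbolSupport_mul_inv]
  · filter_upwards [coeFn_mulOp (hβ.sqrtSymbol_memLp hr) (h.2.toLp _), h.2.coeFn_toLp, h.1]
      with ξ h1 h2 h3
    rw [h1, h2, symbolMul_eq u hβ, ← mul_assoc]
    rcases eq_or_ne (sqrtSymbol β ξ) 0 with h4 | h4
    · rw [h3 ((hβ.sqrtSymbol_eq_zero_iff ξ).1 h4), mul_zero]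
    · rw [mul_inv_cancel₀ h4, one_mul]

/-- Integrating the forcing in time therefore preserves the support condition required by
`IsKernel.inDomR_of_eq`. -/
theorem symbolSupport_forcing (hs : 1 ≤ s) {F : ℝ → ℝ} (hF : ContDiff ℝ 2 F) (hβ : IsKernel β r)
    (hr : 2 ≤ r) (w : X s) :
    mulOp hβ.symbolSupport_memLp (forcing hs hF hβ hr w) = forcing hs hF hβ hr w := by
  refine Lp.ext ?_
  filter_upwards [coeFn_mulOp hβ.symbolSupport_memLp (forcing hs hF hβ hr w),
    coeFn_forcing hs hF hβ hr w] with ξ h1 h2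
  rw [h1, h2, ← mul_assoc, symbolSupport_mul]

theorem conj_derivSymbol_mul_sqrtSymbol (i : Fin 2) (ξ : Plane) :
    starRingEnd ℂ ((derivSymbol i * sqrtSymbol β) ξ) = -(derivSymbol i * sqrtSymbol β) ξ := by
  simp [derivSymbol, sqrtSymbol, Complex.conj_ofNat]

/-- Power balance: if `û = β̂^{1/2} q`, then `Re ⟨q, β̂^{1/2} Σ 2πi ξ_i (∂F/∂w_i)^⟩` is
`-Σ ∫ ∂F/∂w_i · ∂_i u`. -/
theorem re_inner_forcing (hs : 1 ≤ s) {F : ℝ → ℝ} (hF : ContDiff ℝ 2 F) (hβ : IsKernel β r)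
    (hr : 2 ≤ r) (w u : X s) {q : L2C}
    (hq : mulOp (hβ.sqrtSymbol_memLp hr) q = hatL2 (zero_le_one.trans hs) u) :
    (inner ℂ q (forcing hs hF hβ hr w)).re =
      -∑ i : Fin 2, reInner (fluxL2 hs hF i w) (gradL2 hs i u) := by
  rw [forcing, inner_sum, Complex.re_sum, ← Finset.sum_neg_distrib]
  refine Finset.sum_congr rfl fun i _ => ?_
  have hκ := hβ.derivSymbol_mul_sqrtSymbol_memLp hr i
  -- The symbol is imaginary, so its adjoint is its negative. This is integration by parts: moved
  -- onto `q`, it produces `-𝓕(∂_i u)`, and Plancherel finishes.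
  have h1 : mulOp hκ.neg q = -𝓕 (gradL2 hs i u) := by
    refine Lp.ext ?_
    have h2 := coeFn_mulOp (hβ.sqrtSymbol_memLp hr) q
    rw [hq] at h2
    filter_upwards [coeFn_mulOp hκ.neg q, Lp.coeFn_neg (𝓕 (gradL2 hs i u)),
      coeFn_fourier_gradL2 hs i u, h2] with ξ h3 h4 h5 h6
    rw [h3, h4, Pi.neg_apply, Pi.neg_apply, h5, h6, Pi.mul_apply]
    ring
  rw [← inner_mulOp_left hκ.neg q _ hκ fun ξ => by
    rw [Pi.neg_apply, map_neg, conj_derivSymbol_mul_sqrtSymbol, neg_neg], h1, inner_neg_left,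
    Lp.inner_fourier_eq, Complex.neg_re, reInner_apply]
  congr 1
  exact inner_re_symm (𝕜 := ℂ) _ _

end Operator

/-! ### Conservation of energy along a solution -/

section Solution

variable {F : ℝ → ℝ} {φ ψ : X s} {T : EReal} {w : ℝ → X s}

theorem IsSolution.hasDerivWithinAt (hw : IsSolution β F φ ψ T w) {t : ℝ}
    (ht : t ∈ timeInterval T) : HasDerivWithinAt w (velocity T w t) (timeInterval T) t :=
  (hw.contDiffOn.differentiableOn (by norm_num) t ht).hasDerivWithinAt

theorem IsSolution.hasDerivWithinAt_velocity (hw : IsSolution β F φ ψ T w) {t : ℝ}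
    (ht : t ∈ timeInterval T) : HasDerivWithinAt (velocity T w)
      (iteratedDerivWithin 2 w (timeInterval T) t) (timeInterval T) t := by
  have h1 : iteratedDerivWithin 1 w (timeInterval T) = velocity T w :=
    iteratedDerivWithin_one
  have h2 := hw.contDiffOn.differentiableOn_iteratedDerivWithin (m := 1) (by norm_num)
    (uniqueDiffOn_timeInterval T) t ht
  rw [h1] at h2
  rw [show (2 : ℕ) = 1 + 1 from rfl, iteratedDerivWithin_succ, h1]
  exact h2.hasDerivWithinAt

/-- Along a solution, `(R w_t)^` is a primitive of the forcing. -/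
theorem IsSolution.exists_primitive (hs : 1 ≤ s) (hr : 2 ≤ r) (hβ : IsKernel β r)
    (hF : ContDiff ℝ 2 F) (hw : IsSolution β F φ ψ T w) (hψ : InDomR β (X.toL2 ψ))
    {b : ℝ} (hb : b ∈ timeInterval T) :
    ∃ Q : ℝ → L2C, ∀ t ∈ Icc 0 b,
      HasDerivAt Q (forcing hs hF hβ hr (w t)) t ∧
      mulOp hβ.symbolSupport_memLp (Q t) = Q t ∧
      mulOp (hβ.sqrtSymbol_memLp hr) (Q t) = hatL2 (zero_le_one.trans hs) (velocity T w t) := by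
  have hs0 : 0 ≤ s := zero_le_one.trans hs
  obtain ⟨q, hq1, hq2⟩ := hβ.exists_of_inDomR hr hψ
  have hsub := Icc_subset_timeInterval hb
  have hwc : ContinuousOn w (Icc 0 b) := hw.contDiffOn.continuousOn.mono hsub
  -- Extending by the endpoint values gives a function continuous on all of `ℝ`, so its primitive
  -- has two-sided derivatives even at `0` and `b`.
  let G : ℝ → L2C := IccExtend hb.1 ((Icc 0 b).domRestrict fun t => forcing hs hF hβ hr (w t))
  have hG : Continuous G := continuous_IccExtend_iff.2
    ((continuous_forcing hs hF hβ hr).comp_continuousOn hwc).domRestrict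
  have hGeq : ∀ t ∈ Icc 0 b, G t = forcing hs hF hβ hr (w t) := fun t ht => by
    simp only [G, IccExtend_of_mem hb.1 _ ht, domRestrict_apply]
  have hGsupp : ∀ t, mulOp hβ.symbolSupport_memLp (G t) = G t := fun t =>
    symbolSupport_forcing hs hF hβ hr _
  refine ⟨fun t => q + ∫ x in (0 : ℝ)..t, G x, fun t ht => ⟨?_, ?_, ?_⟩⟩
  · rw [← hGeq t ht]
    exact (hG.integral_hasStrictDerivAt 0 t).hasDerivAt.const_add q
  · rw [map_add, hq1, ← ContinuousLinearMap.intervalIntegral_comp_comm _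
      (hG.intervalIntegrable 0 t)]
    simp only [hGsupp]
  · have hcont : ContinuousOn (fun x => hatL2 hs0 (velocity T w x)) (uIcc 0 t) := by
      rw [uIcc_of_le ht.1]
      intro x hx
      have hx' : x ∈ timeInterval T := hsub ⟨hx.1, hx.2.trans ht.2⟩
      exact ((hatL2 hs0).continuous.continuousAt.comp_continuousWithinAt
        (hw.hasDerivWithinAt_velocity hx').continuousWithinAt).mono
          ((Icc_subset_Icc_right ht.2).trans hsub)
    -- The equation is available only for positive times; right derivatives inside the interval and
    -- continuity up to `0` suffice for the fundamental theorem of calculus.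
    have hder : ∀ x ∈ Ioo (min 0 t) (max 0 t), HasDerivWithinAt
        (fun x => hatL2 hs0 (velocity T w x)) (mulOp (hβ.sqrtSymbol_memLp hr) (G x)) (Ioi x) x := by
      intro x hx
      rw [min_eq_left ht.1, max_eq_right ht.1] at hx
      have hxb : x ∈ Icc 0 b := ⟨hx.1.le, hx.2.le.trans ht.2⟩
      rw [hGeq x hxb,
        ← IsK.hatL2_eq_mulOp_forcing hs hF hβ hr (hw.equation x (hsub hxb) hx.1)]
      exact ((hatL2 hs0).hasFDerivAt.comp_hasDerivWithinAt x
        (hw.hasDerivWithinAt_velocity (hsub hxb))).mono_of_mem_nhdsWithin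
          (nhdsWithin_mono x Ioi_subset_Ici_self (timeInterval_mem_nhdsGE (hsub hxb)))
    have hint := intervalIntegral.integral_eq_sub_of_hasDeriv_right hcont hder
      (((mulOp (hβ.sqrtSymbol_memLp hr)).continuous.comp hG).intervalIntegrable 0 t)
    rw [map_add, ← ContinuousLinearMap.intervalIntegral_comp_comm _ (hG.intervalIntegrable 0 t),
      hint, ← hq2, ← hatL2_eq hs0, hw.init_velocity]
    abel

theorem IsSolution.energy_eq (hs : 1 ≤ s) (hr : 2 ≤ r) (hβ : IsKernel β r)
    (hF : ContDiff ℝ 2 F) (hF0 : F 0 = 0) (hw : IsSolution β F φ ψ T w)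
    (hψ : InDomR β (X.toL2 ψ)) {b : ℝ} (hb : b ∈ timeInterval T) :
    InDomR β (X.toL2 (velocity T w b)) ∧ energy β F T w b = energy β F T w 0 := by
  have hs0 : 0 ≤ s := zero_le_one.trans hs
  obtain ⟨Q, hQ⟩ := hw.exists_primitive hs hr hβ hF hψ hb
  have hsub := Icc_subset_timeInterval hb
  have hR : ∀ t ∈ Icc 0 b, InDomR β (X.toL2 (velocity T w t)) ∧
      ‖R β (X.toL2 (velocity T w t))‖ = ‖Q t‖ := fun t ht => by
    refine hβ.inDomR_of_eq hr (hQ t ht).2.1 ?_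
    rw [← hatL2_eq hs0, (hQ t ht).2.2]
  have hE : ∀ t ∈ Icc 0 b, energy β F T w t =
      1 / 2 * (inner ℂ (Q t) (Q t)).re + ∫ z, F ((w t).gradSq z) := fun t ht => by
    rw [energy, (hR t ht).2, inner_self_eq_norm_sq_to_K]
    norm_cast
  have hder : ∀ t ∈ Icc 0 b, HasDerivWithinAt (fun t => 1 / 2 * (inner ℂ (Q t) (Q t)).re +
      ∫ z, F ((w t).gradSq z)) 0 (timeInterval T) t := fun t ht => by
    have h1 := (((hQ t ht).1.inner ℂ (hQ t ht).1).hasDerivWithinAt (s := timeInterval T))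
    have h2 := Complex.reCLM.hasFDerivAt.comp_hasDerivWithinAt t h1
    have h3 := (hasFDerivAt_potential hs hF hF0 (w t)).comp_hasDerivWithinAt t
      (hw.hasDerivWithinAt (hsub ht))
    -- The kinetic term contributes `Re ⟨Q, forcing⟩`, which the power balance makes the negative of
    -- the potential term.
    refine ((h2.const_mul (1 / 2)).add h3).congr_deriv ?_
    have h4 := re_inner_forcing hs hF hβ hr (w t) (velocity T w t) (hQ t ht).2.2
    have h5 : (inner ℂ (forcing hs hF hβ hr (w t)) (Q t)).re =
      (inner ℂ (Q t) (forcing hs hF hβ hr (w t))).re := inner_re_symm (𝕜 := ℂ) _ _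
    simp only [Complex.reCLM_apply, Complex.add_re, h5, h4, sum_apply,
      ContinuousLinearMap.comp_apply]
    ring
  have hconst := constant_of_has_deriv_right_zero
    (fun t ht => ((hder t ht).continuousWithinAt).mono hsub)
    (fun t ht => (hder t (Ico_subset_Icc_self ht)).mono_of_mem_nhdsWithin
      (timeInterval_mem_nhdsGE (hsub (Ico_subset_Icc_self ht)))) b (right_mem_Icc.2 hb.1)
  refine ⟨(hR b (right_mem_Icc.2 hb.1)).1, ?_⟩
  rw [hE b (right_mem_Icc.2 hb.1), hE 0 (left_mem_Icc.2 hb.1)]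
  exact hconst

end Solution

end NonlocalWave

end

open NonlocalWave in
theorem lemma4p2 (s r : ℝ) (hs : 1 ≤ s) (hr : 2 ≤ r)
    (β : Plane → ℝ) (hβ : IsKernel β r)
    (F : ℝ → ℝ) (hF : ContDiff ℝ ((⌊s⌋₊ + 1 : ℕ) : ℕ∞) F) (hF0 : F 0 = 0)
    (T : EReal) (hT : 0 < T) (φ ψ : X s) (w : ℝ → X s) (hw : IsSolution β F φ ψ T w)
    (hψ : InDomR β (X.toL2 ψ)) (hφ : Integrable (fun z => F (φ.gradSq z))) :
    ∀ t ∈ timeInterval T,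
      InDomR β (X.toL2 (velocity T w t)) ∧
      Integrable (fun z => F ((w t).gradSq z)) ∧
      energy β F T w t = energy β F T w 0 := by
  intro t ht
  have hF2 : ContDiff ℝ 2 F := by
    refine hF.of_le ?_
    -- Since `s ≥ 1`, the assumed smoothness `⌊s⌋ + 1` is at least `2`, which is all that the
    -- argument needs.
    have h1 : 1 ≤ ⌊s⌋₊ := Nat.le_floor (by simpa using hs)
    have h2 : 2 ≤ ⌊s⌋₊ + 1 := by omega
    exact WithTop.coe_le_coe.2 (by exact_mod_cast h2 : (2 : ℕ∞) ≤ ((⌊s⌋₊ + 1 : ℕ) : ℕ∞))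
  obtain ⟨h1, h2⟩ := hw.energy_eq hs hr hβ hF2 hF0 hψ ht
  exact ⟨h1, integrable_density hs hF2 hF0 (w t), h2⟩
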